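/- Let $n\ge 3$. Let $\widetilde\Delta$ be a finite disjoint union of oriented Euclidean $n$-simplices, and let $\Phi$ be a family of orientation-reversing affine isomorphisms (face pairings) that pairs the facets of $\widetilde\Delta$ (no facet being paired with itself). Let $\widehat M=\widetilde\Delta/\Phi$ be the quotient pseudo-manifold, $p\colon\widetilde\Delta\to\widehat M$ the quotient map, and $\widehat M^{(j)}$ the image of the $j$-skeleton. Call a point $y\in\widehat M\setminus\widehat M^{(n-3)}$ regular if $p$ is injective near each $a\in p^{-1}(y)$ on the open face of $\widetilde\Delta$ that contains $a$. (If no $(n-2)$-simplex is glued to itself by a nontrivial symmetry, which is automatic for $n=3$, then all points of $\widehat M\setminus\widehat M^{(n-3)}$ are regular; for $n=3$ they are all points other than the vertices.) The degree of an $(n-2)$-singlex $\tau$ (the image of an $(n-2)$-simplex) is the number of sheets of $p\colon p^{-1}(\tau)\to\tau$, i.e. the number of points of $p^{-1}(y)$ for $y$ regular in the interior of $\tau$. The triangulation is even if every $(n-2)$-singlex has even degree. Let $1<k\le\frac{n+1}{2}$. A $(k,n-k+1)$-normal disc type $\nu$ in an $n$-simplex $\sigma$ is an unordered partition of the vertices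 of $\sigma$ into a set of size $k$ and a set of size $n-k+1$; the standard disc $\overline\nu$ is the convex hull of the midpoints of the edges of $\sigma$ that join the two sets. For a facet $\tau$ of $\sigma$ with face pairing $\varphi_\tau\colon\tau\to\tau'$, $\tau'$ a facet of $\sigma'$, the perspectivity $p_\tau$ is the bijection from the vertices of $\sigma$ to those of $\sigma'$ that extends $\varphi_\tau$ and sends the vertex opposite to $\tau$ to the vertex opposite to $\tau'$. The $(k,n-k+1)$-hypersurface $H$ is obtained from the disjoint union of all the discs $\overline\nu$, one for each $n$-simplex $\sigma$ of $\widetilde\Delta$ and each $(k,n-k+1)$-normal disc type $\nu$ in $\sigma$, by gluing, for each facet $\tau$ of $\sigma$, the face $\overline\nu\cap\tau$ of $\overline\nu$ to the face $\overline{p_\tau(\nu)}\cap\tau'$ of $\overline{p_\tau(\nu)}$ by $\varphi_\tau$. The inclusions of the discs into the simplices induce a map $f\colon H\to\widehat M$. Say that the $(k,n-k+1)$-hypersurface is an immersion (without branching) if each $h\in H$ with $f(h)$ regular has a neighbourhood on which $f$ is injective. Then the $(k,n-k+1)$-hypersurface is an immersion if and only if the triangulation is even. -/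

import Mathlib

open Topology

noncomputable section

namespace PseudoManifold

/-- The standard Euclidean `n`-simplex, in barycentric coordinates; its corners are `Fin (n + 1)`. -/
abbrev Simplex (n : ℕ) : Type := stdSimplex ℝ (Fin (n + 1))

/-- The corners of the smallest face of the simplex that contains `x`. -/
def support {n : ℕ} (x : Simplex n) : Finset (Fin (n + 1)) :=
  Finset.univ.filter fun j => (x : Fin (n + 1) → ℝ) j ≠ 0

/-- A (singular) triangulation: oriented `n`-simplices indexed by `S`, with face pairings.
The facet of `σ` opposite to the corner `i` is written `(σ, i)`. Its face pairing is an affine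
isomorphism onto a facet `(σ', i')`, that is, a bijection from the corners other than `i` to the
corners other than `i'`. Such data are the same as `σ' = nbr σ i` together with the permutation
`perm σ i` that extends this bijection by `i ↦ i'` (the perspectivity of the facet). -/
structure Triangulation (n : ℕ) (S : Type*) where
  /-- the simplex on the other side of the facet `(σ, i)` -/
  nbr : S → Fin (n + 1) → S
  /-- the face pairing of the facet `(σ, i)`, extended by opposite corner to opposite corner -/
  perm : S → Fin (n + 1) → Equiv.Perm (Fin (n + 1))
  /-- the orientation of each simplex, relative to the standard order of its corners -/
  orient : S → ℤˣ
  /-- the inverse of a face pairing is a face pairing -/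
  nbr_nbr : ∀ σ i, nbr (nbr σ i) (perm σ i i) = σ
  perm_nbr : ∀ σ i, perm (nbr σ i) (perm σ i i) = (perm σ i)⁻¹
  /-- no facet is paired with itself -/
  ne_self : ∀ σ i, (nbr σ i, perm σ i i) ≠ (σ, i)
  /-- face pairings reverse the induced orientations; as the extension sends opposite corner to
  opposite corner, this says that the extension reverses the orientations of the simplices -/
  orient_reversing : ∀ σ i, Equiv.Perm.sign (perm σ i) * orient σ * orient (nbr σ i) = -1

namespace Triangulation

variable {n : ℕ} {S : Type*} (T : Triangulation n S)

/-- The disjoint union of the simplices. -/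
abbrev Delta (_T : Triangulation n S) : Type _ := Σ _ : S, Simplex n

/-- `Glue a b`: the point `a` lies in a facet `(σ, i)`, and its face pairing sends `a` to `b`. -/
def Glue (a b : T.Delta) : Prop :=
  ∃ i : Fin (n + 1), a.2 i = 0 ∧ b.1 = T.nbr a.1 i ∧ ∀ j, b.2 (T.perm a.1 i j) = a.2 j

/-- The closed pseudo-manifold: the quotient of the disjoint union of the simplices by the
equivalence relation generated by the face pairings, with the quotient topology. -/
def Space : Type _ := Quot T.Glue

instance : TopologicalSpace T.Space := inferInstanceAs (TopologicalSpace (Quot T.Glue))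

/-- The quotient map. -/
def proj (a : T.Delta) : T.Space := Quot.mk T.Glue a

/-- The image of the `d`-skeleton: the union of all `j`-singlices with `j ≤ d`. -/
def skeleton (d : ℕ) : Set T.Space :=
  T.proj '' {a | (support a.2).card ≤ d + 1}

/-- The quotient map is injective near `a` on the open face of the simplex that contains `a`:
`a` is not fixed by a nontrivial symmetry by which that face is glued to itself. -/
def IsFree (a : T.Delta) : Prop :=
  ∃ V ∈ 𝓝 a.2, ∀ y ∈ V, ∀ z ∈ V, support y = support a.2 → support z = support a.2 →
    T.proj ⟨a.1, y⟩ = T.proj ⟨a.1, z⟩ → y = z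

/-- The regular points: those outside the `(n - 3)`-skeleton that are not fixed by a nontrivial
self-gluing of a face. Only faces of dimension `n - 2` matter here; if none of them is glued to
itself by a nontrivial symmetry, these are all points outside the `(n - 3)`-skeleton. -/
def IsRegular (y : T.Space) : Prop :=
  y ∉ T.skeleton (n - 3) ∧ ∀ a, T.proj a = y → T.IsFree a

/-- The number of points of the disjoint union of simplices over a point. -/
def fibreCard (y : T.Space) : ℕ := (T.proj ⁻¹' {y}).ncard

/-- The triangulation is even: every `(n - 2)`-singlex `τ` has even degree. The degree of `τ` is
the degree (the number of sheets) of the restriction of the quotient map over `τ`, that is, the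
number of points over a regular point in the interior of `τ`. The interior of an `(n - 2)`-simplex
consists of the points with exactly `n - 1` nonzero coordinates. -/
def IsEven : Prop :=
  ∀ a : T.Delta, (support a.2).card = n - 1 → T.IsRegular (T.proj a) →
    Even (T.fibreCard (T.proj a))

end Triangulation

/-- A `(k, n - k + 1)`-normal disc type: an unordered partition of the corners of an `n`-simplex
into a set with `k` elements and its complement. -/
def DiscType (n k : ℕ) : Type :=
  {P : Sym2 (Finset (Fin (n + 1))) // ∃ A : Finset (Fin (n + 1)), A.card = k ∧ P = s(A, Aᶜ)}

/-- The image of a disc type under a permutation of the corners. -/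
def DiscType.map {n k : ℕ} (g : Equiv.Perm (Fin (n + 1))) (ν : DiscType n k) : DiscType n k :=
  ⟨Sym2.map (Finset.map g.toEmbedding) ν.1, by
    obtain ⟨A, hA, h⟩ := ν.2
    refine ⟨A.map g.toEmbedding, by simpa using hA, ?_⟩
    rw [h, Sym2.map_mk]
    congr 2
    ext j
    simp⟩

/-- The corner `i` as a vector of barycentric coordinates. -/
abbrev corner {n : ℕ} (i : Fin (n + 1)) : Fin (n + 1) → ℝ := Pi.single i 1

/-- The standard normal disc of type `ν`: the convex hull of the midpoints of the edges that
join the two sets of the partition. -/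
def disc {n k : ℕ} (ν : DiscType n k) : Set (Simplex n) :=
  {x | (x : Fin (n + 1) → ℝ) ∈ convexHull ℝ {m : Fin (n + 1) → ℝ |
    ∃ A ∈ ν.1, ∃ i ∈ A, ∃ j ∉ A, m = midpoint ℝ (corner i) (corner j)}}

/-- The standard normal disc is the section of the simplex by a hyperplane. -/
theorem mem_disc_iff {n k : ℕ} (ν : DiscType n k) (x : Simplex n) :
    x ∈ disc ν ↔ ∀ A ∈ ν.1, ∑ i ∈ A, (x : Fin (n + 1) → ℝ) i = 1 / 2 := by
  classical
  obtain ⟨A₀, hA₀, hν⟩ := ν.2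
  have hsum : ∀ A : Finset (Fin (n + 1)),
      ∑ i ∈ A, (x : Fin (n + 1) → ℝ) i + ∑ i ∈ Aᶜ, (x : Fin (n + 1) → ℝ) i = 1 := fun A => by
    rw [Finset.sum_add_sum_compl]; exact x.2.2
  have hmem : (∀ A ∈ s(A₀, A₀ᶜ), ∑ i ∈ A, (x : Fin (n + 1) → ℝ) i = 1 / 2) ↔
      ∑ i ∈ A₀, (x : Fin (n + 1) → ℝ) i = 1 / 2 := by
    have := hsum A₀
    simp only [Sym2.mem_iff, forall_eq_or_imp, forall_eq]
    constructor
    · exact fun h => h.1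
    · exact fun h => ⟨h, by linarith⟩
  unfold disc
  rw [hν, hmem, Set.mem_ofPred_eq]
  constructor
  · intro hx
    have hconv : Convex ℝ {f : Fin (n + 1) → ℝ | ∑ i ∈ A₀, f i = 1 / 2} := by
      intro f hf g hg a b _ _ hab
      simp only [Set.mem_ofPred_eq, Pi.add_apply, Pi.smul_apply, smul_eq_mul,
        Finset.sum_add_distrib, ← Finset.mul_sum] at hf hg ⊢
      rw [hf, hg, ← add_mul, hab, one_mul]
    refine convexHull_min ?_ hconv hx
    rintro m ⟨A, hA, i, hi, j, hj, rfl⟩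
    simp only [Set.mem_ofPred_eq, midpoint_eq_smul_add, Pi.smul_apply, Pi.add_apply,
      smul_eq_mul, ← Finset.mul_sum, Finset.sum_add_distrib]
    rcases Sym2.mem_iff.1 hA with rfl | rfl
    · simp [hi, hj]
    · simp at hi hj
      simp [hi, hj]
  · intro hx
    have hx' : ∑ i ∈ A₀ᶜ, (x : Fin (n + 1) → ℝ) i = 1 / 2 := by have := hsum A₀; linarith
    have key : (x : Fin (n + 1) → ℝ) = ∑ p ∈ A₀ ×ˢ A₀ᶜ,
        (4 * ((x : Fin (n + 1) → ℝ) p.1 * (x : Fin (n + 1) → ℝ) p.2)) •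
          midpoint ℝ (corner p.1) (corner p.2) := by
      ext l
      rw [Finset.sum_apply, Finset.sum_product]
      have h1 : ∀ i j : Fin (n + 1), ((4 * ((x : Fin (n + 1) → ℝ) i * (x : Fin (n + 1) → ℝ) j)) •
          midpoint ℝ (corner i) (corner j)) l =
          2 * ((x : Fin (n + 1) → ℝ) j * (Pi.single i ((x : Fin (n + 1) → ℝ) i) : Fin (n + 1) → ℝ) l) +
          2 * ((x : Fin (n + 1) → ℝ) i * (Pi.single j ((x : Fin (n + 1) → ℝ) j) : Fin (n + 1) → ℝ) l) := by
        intro i j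
        simp only [midpoint_eq_smul_add, Pi.smul_apply, Pi.add_apply, smul_eq_mul, Pi.single_apply]
        rw [invOf_eq_inv]
        split_ifs <;> ring
      simp only [h1, Finset.sum_add_distrib, ← Finset.mul_sum, ← Finset.sum_mul, hx, hx',
        Finset.sum_pi_single]
      by_cases hl : l ∈ A₀ <;> simp [hl]
    rw [key]
    refine (convex_convexHull ℝ _).sum_mem ?_ ?_ ?_
    · intro p _
      have h1 := x.2.1 p.1
      have h2 := x.2.1 p.2
      positivity
    · rw [Finset.sum_product]
      simp only [← Finset.mul_sum, ← Finset.sum_mul, hx, hx']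
      norm_num
    · rintro ⟨i, j⟩ hp
      rw [Finset.mem_product, Finset.mem_compl] at hp
      exact subset_convexHull ℝ _ ⟨A₀, by simp, i, hp.1, j, hp.2, rfl⟩

namespace Triangulation

variable {n : ℕ} {S : Type*} (T : Triangulation n S)

/-- The disjoint union of normal discs, one of each type `(k, n - k + 1)` in each simplex. -/
abbrev Discs (_T : Triangulation n S) (k : ℕ) : Type _ :=
  Σ p : S × DiscType n k, disc p.2

/-- The gluing of the discs. If the point `a` of the disc of type `ν` in `σ` lies in the facet
`(σ, i)`, it is identified with its image under the face pairing, in the disc of type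
`perm σ i (ν)` of the adjacent simplex. -/
def DiscGlue (k : ℕ) (a b : T.Discs k) : Prop :=
  ∃ i : Fin (n + 1), a.2.1 i = 0 ∧
    b.1 = (T.nbr a.1.1 i, a.1.2.map (T.perm a.1.1 i)) ∧
    ∀ j, b.2.1 (T.perm a.1.1 i j) = a.2.1 j

/-- The `(k, n - k + 1)`-hypersurface as an abstract complex, with the quotient topology. -/
def Hypersurface (k : ℕ) : Type _ := Quot (T.DiscGlue k)

instance (k : ℕ) : TopologicalSpace (T.Hypersurface k) :=
  inferInstanceAs (TopologicalSpace (Quot (T.DiscGlue k)))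

/-- The natural map of the `(k, n - k + 1)`-hypersurface to the pseudo-manifold, induced by the
inclusions of the discs into the simplices. -/
def hypersurfaceMap (k : ℕ) : T.Hypersurface k → T.Space :=
  Quot.lift (fun a => T.proj ⟨a.1.1, a.2.1⟩) (by
    rintro a b ⟨i, hi, hb, h⟩
    exact Quot.sound ⟨i, hi, congrArg Prod.fst hb, h⟩)

/-- The `(k, n - k + 1)`-hypersurface is an immersion (without branching): its natural map is
locally injective at every point that lies over a regular point of the pseudo-manifold. -/
def HypersurfaceIsImmersion (k : ℕ) : Prop :=
  ∀ h : T.Hypersurface k, T.IsRegular (T.hypersurfaceMap k h) →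
    ∃ U ∈ 𝓝 h, Set.InjOn (T.hypersurfaceMap k) U

end Triangulation

end PseudoManifold

end

namespace PseudoManifold

/-! Branching of the hypersurface is a matter of holonomy. The fibres of both quotients are swept
out by chains of facet crossings, each chain moving the corners by a permutation `w` (`proj_eq_iff`,
`chain_of_discs_mk_eq`). Two discs that meet at a point of the hypersurface and lie in the same
simplex at the same point `x` have types related by the `w` of a closed chain at `x`. If `x` is
regular, `w` fixes all corners of the open face of `x` (`IsFree.apply_eq_self`). So `w` can be
nontrivial only on a face of codimension two, and there it is the exchange of the two opposite
corners `i`, `j`.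

Whether the exchange occurs is a question of parity. Crossing a facet and turning to the other facet
are fixed-point-free involutions on flags; in the dihedral action that they generate, no power of
their product acts at a flag like a turn (`walk_zpow_ne_turn`). Hence the parity of a closed chain
decides whether it exchanges the two facets (`Chain.loop_apply`), and the degree of the face is the
period of the walk around it (`fibreCard_eq_minimalPeriod`). Even degree excludes the exchange
(`IsEven.loop_eq_one`); odd degree produces it (`exists_chain_swap_of_odd`).

Without the exchange, distinct sheets through a point are never joined there. With it, a disc that
separates `i` from `j` is joined along the face to its mirror image, and the two discs overlap at
nearby interior points with equal `i` and `j` coordinates. A regular point on such a disc comes from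
generic coordinates; for `n = 3` these may be forced to coincide, and orientations rule out the flip
of an edge instead. -/

/-! ### Permutations of corners acting on points and disc types. -/

/-- The simplicial automorphism that moves each corner `i` to the corner `w i`. -/
def Simplex.permute {n : ℕ} (w : Equiv.Perm (Fin (n + 1))) (x : Simplex n) : Simplex n :=
  ⟨fun l => x (w.symm l), fun l => x.2.1 (w.symm l), by
    rw [← x.2.2]
    exact Equiv.sum_comp w.symm (x : Fin (n + 1) → ℝ)⟩

@[simp] theorem Simplex.permute_apply {n : ℕ} (w : Equiv.Perm (Fin (n + 1))) (x : Simplex n)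
    (l : Fin (n + 1)) : Simplex.permute w x l = x (w.symm l) := rfl

@[simp] theorem symm_mul_apply {ι : Type*} (g h : Equiv.Perm ι) (l : ι) :
    (g * h).symm l = h.symm (g.symm l) := rfl

theorem Simplex.ext {n : ℕ} {x y : Simplex n} (h : ∀ l, x l = y l) : x = y := by
  ext l; exact h l

/-- The zero set of a vector of barycentric coordinates. -/
def zeros {n : ℕ} (x : Simplex n) : Set (Fin (n + 1)) := {l | x l = 0}

theorem mem_zeros {n : ℕ} {x : Simplex n} {l : Fin (n + 1)} : l ∈ zeros x ↔ x l = 0 := Iff.rfl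

theorem Simplex.permute_one {n : ℕ} (x : Simplex n) : x.permute 1 = x := rfl

theorem Simplex.permute_mul {n : ℕ} (g h : Equiv.Perm (Fin (n + 1))) (x : Simplex n) :
    x.permute (g * h) = (x.permute h).permute g := Simplex.ext fun l => by simp

theorem zeros_permute {n : ℕ} (w : Equiv.Perm (Fin (n + 1))) (x : Simplex n) :
    zeros (x.permute w) = w '' zeros x := by
  ext l
  simp [mem_zeros, Equiv.image_eq_preimage_symm]

theorem mem_support {n : ℕ} {x : Simplex n} {l : Fin (n + 1)} : l ∈ support x ↔ x l ≠ 0 := by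
  simp only [support, Finset.mem_filter, Finset.mem_univ, true_and]

theorem support_eq_support_iff {n : ℕ} {x y : Simplex n} :
    support x = support y ↔ zeros x = zeros y := by
  simp only [Finset.ext_iff, Set.ext_iff, mem_support, mem_zeros, not_iff_not]

theorem DiscType.map_one {n k : ℕ} (ν : DiscType n k) : ν.map 1 = ν := by
  apply Subtype.ext
  change Sym2.map (Finset.map (Equiv.refl _).toEmbedding) ν.1 = ν.1
  have : (Finset.map (Equiv.refl (Fin (n + 1))).toEmbedding) = id := by ext A; simp
  rw [this, Sym2.map_id, id]

theorem DiscType.map_mul {n k : ℕ} (g h : Equiv.Perm (Fin (n + 1))) (ν : DiscType n k) :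
    ν.map (g * h) = (ν.map h).map g := by
  apply Subtype.ext
  simp only [DiscType.map, Sym2.map_map]
  congr 1
  ext A l
  simp only [Function.comp_apply, Finset.map_map]
  rfl

theorem permute_mem_disc {n k : ℕ} {ν : DiscType n k} {x : Simplex n} (hx : x ∈ disc ν)
    (w : Equiv.Perm (Fin (n + 1))) : x.permute w ∈ disc (ν.map w) := by
  rw [mem_disc_iff] at hx ⊢
  intro A hA
  simp only [DiscType.map, Sym2.mem_map] at hA
  obtain ⟨B, hB, rfl⟩ := hA
  rw [← hx B hB, Finset.sum_map]
  refine Finset.sum_congr rfl fun l _ => ?_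
  change x (w.symm (w l)) = x l
  simp

/-! ### Chains of facet crossings and the fibres of the two quotients. -/

namespace Triangulation

variable {n : ℕ} {S : Type*} (T : Triangulation n S)

/-- `T.Chain Z σ m σ' w`: a sequence of `m` face pairings, each of them across a facet opposite to
the image of a corner in `Z`, leads from `σ` to `σ'` and moves the corners by `w`. -/
inductive Chain (Z : Set (Fin (n + 1))) (σ : S) : ℕ → S → Equiv.Perm (Fin (n + 1)) → Prop
  | nil : Chain Z σ 0 σ 1
  | step {m : ℕ} {σ' : S} {w : Equiv.Perm (Fin (n + 1))} {c : Fin (n + 1)}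
      (h : Chain Z σ m σ' w) (hc : c ∈ Z) :
      Chain Z σ (m + 1) (T.nbr σ' (w c)) (T.perm σ' (w c) * w)

variable {T}

theorem Chain.mono {Z Z' : Set (Fin (n + 1))} {σ σ' : S} {m : ℕ} {w : Equiv.Perm (Fin (n + 1))}
    (h : T.Chain Z σ m σ' w) (hZ : Z ⊆ Z') : T.Chain Z' σ m σ' w := by
  induction h with
  | nil => exact .nil
  | step _ hc ih => exact ih.step (hZ hc)

theorem Chain.trans {Z : Set (Fin (n + 1))} {σ σ' σ'' : S} {m m' : ℕ}
    {w w' : Equiv.Perm (Fin (n + 1))} (h : T.Chain Z σ m σ' w) (h' : T.Chain (w '' Z) σ' m' σ'' w') :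
    T.Chain Z σ (m + m') σ'' (w' * w) := by
  induction h' with
  | nil => simpa using h
  | step _ hc ih =>
    obtain ⟨c, hc, rfl⟩ := hc
    exact ih.step hc

theorem Chain.symm {Z : Set (Fin (n + 1))} {σ σ' : S} {m : ℕ}
    {w : Equiv.Perm (Fin (n + 1))} (h : T.Chain Z σ m σ' w) :
    T.Chain (w '' Z) σ' m σ w⁻¹ := by
  induction h with
  | nil => simpa using Chain.nil
  | @step m σ' w c h hc ih =>
    have h1 : T.Chain ((T.perm σ' (w c) * w : Equiv.Perm (Fin (n + 1))) '' Z)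
        (T.nbr σ' (w c)) 1 σ' (T.perm σ' (w c))⁻¹ := by
      have := (Chain.nil (T := T) (Z := (T.perm σ' (w c) * w : Equiv.Perm (Fin (n + 1))) '' Z)
        (σ := T.nbr σ' (w c))).step (c := T.perm σ' (w c) (w c)) ⟨c, hc, rfl⟩
      simpa [T.nbr_nbr, T.perm_nbr] using this
    have h2 := h1.trans (m' := m) (σ'' := σ) (w' := w⁻¹) (by
      rw [← Set.image_comp]
      convert ih using 2
      simp [Function.comp_def])
    rw [mul_inv_rev]
    exact add_comm 1 m ▸ h2

/-- Each crossing reverses orientation, so it contributes one factor `-1`. -/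
theorem Chain.sign {Z : Set (Fin (n + 1))} {σ σ' : S} {m : ℕ}
    {w : Equiv.Perm (Fin (n + 1))} (h : T.Chain Z σ m σ' w) :
    Equiv.Perm.sign w * T.orient σ * T.orient σ' = (-1) ^ m := by
  induction h with
  | nil => simp
  | @step m σ' w c h hc ih =>
    have h1 := T.orient_reversing σ' (w c)
    rw [pow_succ, ← ih, ← h1, Equiv.Perm.sign_mul]
    have := Int.units_mul_self (T.orient σ')
    calc _ = Equiv.Perm.sign (T.perm σ' (w c)) * Equiv.Perm.sign w * T.orient σ *
          T.orient (T.nbr σ' (w c)) * 1 := by rw [mul_one]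
      _ = _ := by rw [← this]; simp only [mul_comm, mul_left_comm, mul_assoc]

theorem Chain.sign_loop {Z : Set (Fin (n + 1))} {σ : S} {m : ℕ}
    {w : Equiv.Perm (Fin (n + 1))} (h : T.Chain Z σ m σ w) : Equiv.Perm.sign w = (-1) ^ m := by
  rw [← h.sign, mul_assoc, Int.units_mul_self, mul_one]

theorem glue_symm {a b : T.Delta} (h : T.Glue a b) : T.Glue b a := by
  obtain ⟨σ, x⟩ := a
  obtain ⟨σ', y⟩ := b
  obtain ⟨i, hi, h1, h2⟩ := h
  dsimp only at *
  subst h1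
  refine ⟨T.perm σ i i, by rw [h2, hi], (T.nbr_nbr σ i).symm, fun j => ?_⟩
  dsimp only
  rw [T.perm_nbr, ← h2]
  simp

theorem discGlue_symm {k : ℕ} {a b : T.Discs k} (h : T.DiscGlue k a b) : T.DiscGlue k b a := by
  obtain ⟨⟨σ, ν⟩, x, hx⟩ := a
  obtain ⟨⟨σ', ν'⟩, y, hy⟩ := b
  obtain ⟨i, hi, h1, h2⟩ := h
  simp only [Prod.mk.injEq] at *
  obtain ⟨rfl, rfl⟩ := h1
  refine ⟨T.perm σ i i, by rw [h2, hi], ?_, fun j => ?_⟩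
  · dsimp only
    rw [T.nbr_nbr, T.perm_nbr, ← DiscType.map_mul, inv_mul_cancel, DiscType.map_one]
  · dsimp only
    rw [T.perm_nbr, ← h2]
    simp

theorem reflTransGen_of_mk_eq {α : Type*} {r : α → α → Prop} (hr : ∀ a b, r a b → r b a) {a b : α}
    (h : Quot.mk r a = Quot.mk r b) : Relation.ReflTransGen r a b := by
  replace h := Quot.eqvGen_exact h
  have hs : ∀ a b, Relation.ReflTransGen r a b → Relation.ReflTransGen r b a := fun a b hab => by
    induction hab with
    | refl => exact .refl
    | tail _ h ih => exact .head (hr _ _ h) ih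
  induction h with
  | rel _ _ h => exact .single h
  | refl => exact .refl
  | symm _ _ _ ih => exact hs _ _ ih
  | trans _ _ _ _ _ ih1 ih2 => exact ih1.trans ih2

theorem Chain.proj_eq {x : Simplex n} {σ σ' : S} {m : ℕ} {w : Equiv.Perm (Fin (n + 1))}
    (h : T.Chain (zeros x) σ m σ' w) : T.proj ⟨σ, x⟩ = T.proj ⟨σ', x.permute w⟩ := by
  induction h with
  | nil => rfl
  | @step m σ' w c h hc ih =>
    rw [ih]
    exact Quot.sound ⟨w c, by simpa [mem_zeros] using hc, rfl, fun j => by simp⟩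

theorem proj_eq_iff {σ σ' : S} {x x' : Simplex n} :
    T.proj ⟨σ, x⟩ = T.proj ⟨σ', x'⟩ ↔
      ∃ m w, T.Chain (zeros x) σ m σ' w ∧ x' = x.permute w := by
  constructor
  · intro h
    replace h := reflTransGen_of_mk_eq (fun _ _ => glue_symm) h
    generalize hb : (⟨σ', x'⟩ : T.Delta) = b at h
    induction h generalizing σ' x' with
    | refl => cases hb; exact ⟨0, 1, .nil, by ext l; rfl⟩
    | @tail b c _ h ih =>
      obtain ⟨m, w, h1, h2⟩ := ih (σ' := b.1) (x' := b.2) rfl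
      obtain ⟨i, hi, hs, hx⟩ := h
      subst hb
      dsimp only at hs hx
      subst hs
      have hwi : w.symm i ∈ zeros x := by rw [h2] at hi; exact hi
      have := h1.step hwi
      simp only [Equiv.apply_symm_apply] at this
      refine ⟨_, _, this, Simplex.ext fun l => ?_⟩
      have := hx ((T.perm b.1 i).symm l)
      rw [Equiv.apply_symm_apply] at this
      rw [this, h2]
      simp
  · rintro ⟨m, w, h, rfl⟩
    exact h.proj_eq

theorem discs_mk_congr {k : ℕ} (σ : S) {ν ν' : DiscType n k} {x x' : Simplex n}
    {hx : x ∈ disc ν} {hx' : x' ∈ disc ν'} (hν : ν = ν') (hxx' : x = x') :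
    Quot.mk (T.DiscGlue k) ⟨(σ, ν), x, hx⟩ = Quot.mk (T.DiscGlue k) ⟨(σ, ν'), x', hx'⟩ := by
  subst hν hxx'; rfl

theorem Chain.discs_mk_eq {k : ℕ} {σ σ' : S} {ν : DiscType n k} {x : Simplex n} (hx : x ∈ disc ν)
    {m : ℕ} {w : Equiv.Perm (Fin (n + 1))} (h : T.Chain (zeros x) σ m σ' w) :
    Quot.mk (T.DiscGlue k) ⟨(σ, ν), x, hx⟩ =
      Quot.mk (T.DiscGlue k) ⟨(σ', ν.map w), x.permute w, permute_mem_disc hx w⟩ := by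
  induction h with
  | nil => exact discs_mk_congr _ (DiscType.map_one ν).symm rfl
  | @step m σ' w c h hc ih =>
    rw [ih]
    exact Quot.sound ⟨w c, by simpa [mem_zeros] using hc, by simp [DiscType.map_mul], fun j => by simp⟩

/-- A disc gluing is a facet crossing that also carries the disc type along. Compared with
`proj_eq_iff`, the extra information is that a single `w` moves both the point and the type. -/
theorem chain_of_discs_mk_eq {k : ℕ} {σ σ' : S} {ν ν' : DiscType n k} {x x' : Simplex n}
    {hx : x ∈ disc ν} {hx' : x' ∈ disc ν'}
    (h : Quot.mk (T.DiscGlue k) ⟨(σ, ν), x, hx⟩ = Quot.mk (T.DiscGlue k) ⟨(σ', ν'), x', hx'⟩) :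
    ∃ m w, T.Chain (zeros x) σ m σ' w ∧ ν' = ν.map w ∧ x' = x.permute w := by
  replace h := reflTransGen_of_mk_eq (fun _ _ => discGlue_symm) h
  generalize hb : (⟨(σ', ν'), x', hx'⟩ : T.Discs k) = b at h
  induction h generalizing σ' ν' x' with
  | refl => cases hb; exact ⟨0, 1, .nil, (DiscType.map_one _).symm, by ext l; rfl⟩
  | @tail b c _ h ih =>
    obtain ⟨⟨τ, ν₁⟩, x₁, hx₁⟩ := b
    obtain ⟨m, w, h1, h2, h3⟩ := ih rfl
    obtain ⟨i, hi, hs, hx⟩ := h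
    subst hb
    simp only [Prod.mk.injEq] at hs hx hi
    obtain ⟨rfl, rfl⟩ := hs
    have hwi : w.symm i ∈ zeros x := by rw [h3] at hi; exact hi
    have := h1.step hwi
    simp only [Equiv.apply_symm_apply] at this
    refine ⟨_, _, this, by rw [h2, DiscType.map_mul], Simplex.ext fun l => ?_⟩
    have := hx ((T.perm τ i).symm l)
    rw [Equiv.apply_symm_apply] at this
    rw [this, h3]
    simp

end Triangulation

/-! ### The walk around a face of codimension two. -/

/-- In a group of permutations generated by two involutions without fixed points, no power of the
product of the generators acts at a point like one of the generators. -/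
theorem zpow_mul_apply_ne_of_involutions {F : Type*} {α β : Equiv.Perm F} (hα : α * α = 1)
    (hβ : β * β = 1) (hα' : ∀ f, α f ≠ f) (hβ' : ∀ f, β f ≠ f) (e : ℤ) (f : F) :
    ((β * α) ^ e) f ≠ β f := by
  have hα1 : α⁻¹ = α := inv_eq_of_mul_eq_one_left hα
  have hβ1 : β⁻¹ = β := inv_eq_of_mul_eq_one_left hβ
  have hconj : ∀ m : ℤ, (β * α) ^ (-m) * β = β * (β * α) ^ m := fun m => by
    have h1 : β * (β * α) * β⁻¹ = (β * α)⁻¹ := by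
      rw [mul_inv_rev, hα1, hβ1, ← mul_assoc, hβ, one_mul]
    have h2 := conj_zpow (a := β) (b := β * α) (i := m)
    rw [h1, inv_zpow, ← zpow_neg] at h2
    rw [h2, inv_mul_cancel_right]
  intro h
  -- As `β` inverts `β * α`, halving the exponent shows that the point `(β * α) ^ m f` is fixed by
  -- `β` if `e = 2 * m`, and by `α` if `e = 2 * m + 1`.
  rcases Int.even_or_odd' e with ⟨m, rfl | rfl⟩
  · apply hβ' (((β * α) ^ m) f)
    rw [← Equiv.Perm.mul_apply, ← hconj, Equiv.Perm.mul_apply, ← h, ← Equiv.Perm.mul_apply,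
      ← zpow_add]
    congr 2; ring
  · apply hα' (((β * α) ^ m) f)
    apply β.injective
    have h1 := congrArg ((β * α) ^ (-m)) h
    rw [← Equiv.Perm.mul_apply, ← zpow_add, ← Equiv.Perm.mul_apply _ β, hconj,
      show -m + (2 * m + 1) = 1 + m by ring, zpow_add, zpow_one] at h1
    exact h1

namespace Triangulation

variable {n : ℕ} {S : Type*} (T : Triangulation n S)

/-- A point of a simplex together with an ordered pair of distinct facets of the simplex. -/
abbrev Flag : Type _ := {f : T.Delta × Fin (n + 1) × Fin (n + 1) // f.2.1 ≠ f.2.2}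

/-- Crossing the first facet of a flag. -/
def cross : Equiv.Perm T.Flag :=
  Function.Involutive.toPerm
    (fun f => ⟨(⟨T.nbr f.1.1.1 f.1.2.1, f.1.1.2.permute (T.perm f.1.1.1 f.1.2.1)⟩,
      T.perm f.1.1.1 f.1.2.1 f.1.2.1, T.perm f.1.1.1 f.1.2.1 f.1.2.2),
      fun h => f.2 ((T.perm f.1.1.1 f.1.2.1).injective h)⟩) (by
    rintro ⟨⟨⟨σ, x⟩, i, j⟩, h⟩
    apply Subtype.ext
    simp only [T.nbr_nbr, T.perm_nbr, ← Simplex.permute_mul, inv_mul_cancel, Simplex.permute_one]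
    simp)

/-- Exchanging the two facets of a flag. -/
def turn : Equiv.Perm T.Flag :=
  Function.Involutive.toPerm (fun f => ⟨(f.1.1, f.1.2.2, f.1.2.1), f.2.symm⟩) fun _ => rfl

/-- The step of the walk around the intersection of the two facets of a flag. -/
def walk : Equiv.Perm T.Flag := T.turn * T.cross

theorem cross_mul_self : T.cross * T.cross = 1 :=
  Equiv.ext fun f => Function.Involutive.toPerm_involutive _ f

theorem turn_mul_self : T.turn * T.turn = 1 := rfl

/-- A flag fixed by the crossing would give a facet paired with itself. -/
theorem cross_ne (f : T.Flag) : T.cross f ≠ f := fun h => by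
  have h := congrArg Subtype.val h
  apply T.ne_self f.1.1.1 f.1.2.1
  have h1 := congrArg (fun z => z.1.1) h
  have h2 := congrArg (fun z => z.2.1) h
  exact Prod.ext h1 h2

theorem turn_ne (f : T.Flag) : T.turn f ≠ f := fun h =>
  f.2.symm (congrArg (fun z => z.1.2.1) h)

theorem walk_zpow_ne_turn (e : ℤ) (f : T.Flag) : (T.walk ^ e) f ≠ T.turn f :=
  zpow_mul_apply_ne_of_involutions T.cross_mul_self T.turn_mul_self T.cross_ne T.turn_ne e f

theorem walk_val (f : T.Flag) : (T.walk f).1 =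
    (⟨T.nbr f.1.1.1 f.1.2.1, f.1.1.2.permute (T.perm f.1.1.1 f.1.2.1)⟩,
      T.perm f.1.1.1 f.1.2.1 f.1.2.2, T.perm f.1.1.1 f.1.2.1 f.1.2.1) := rfl

theorem walk_inv_val (f : T.Flag) : (T.walk⁻¹ f).1 =
    (⟨T.nbr f.1.1.1 f.1.2.2, f.1.1.2.permute (T.perm f.1.1.1 f.1.2.2)⟩,
      T.perm f.1.1.1 f.1.2.2 f.1.2.2, T.perm f.1.1.1 f.1.2.2 f.1.2.1) := rfl

variable {T}

/-- A chain of facet crossings around a face of codimension two follows the walk around it. -/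
theorem Chain.exists_walk_zpow {σ σ' : S} {i j : Fin (n + 1)} (hij : i ≠ j) (x : Simplex n)
    {m : ℕ} {w : Equiv.Perm (Fin (n + 1))} (h : T.Chain {i, j} σ m σ' w) :
    ∃ e : ℤ, (Even m ∧ Even e ∧
        ((T.walk ^ e) ⟨(⟨σ, x⟩, i, j), hij⟩).1 = (⟨σ', x.permute w⟩, w i, w j)) ∨
      (Odd m ∧ Odd e ∧
        ((T.walk ^ e) ⟨(⟨σ, x⟩, i, j), hij⟩).1 = (⟨σ', x.permute w⟩, w j, w i)) := by
  induction h with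
  | nil => exact ⟨0, .inl ⟨Even.zero, Even.zero, rfl⟩⟩
  | @step m σ' w c h hc ih =>
    obtain ⟨e, ih⟩ := ih
    have h1 : (T.walk ^ (e + 1)) ⟨(⟨σ, x⟩, i, j), hij⟩ =
        T.walk ((T.walk ^ e) ⟨(⟨σ, x⟩, i, j), hij⟩) := by
      rw [add_comm, zpow_add, zpow_one]; rfl
    have h2 : (T.walk ^ (e - 1)) ⟨(⟨σ, x⟩, i, j), hij⟩ =
        T.walk⁻¹ ((T.walk ^ e) ⟨(⟨σ, x⟩, i, j), hij⟩) := by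
      rw [sub_eq_neg_add, zpow_add, zpow_neg_one]; rfl
    -- The walk crosses the first facet of the flag, its inverse the second. Each crossing of the
    -- chain is therefore one step forward or backward, and either one changes the parity.
    rcases ih with ⟨hm, he, ih⟩ | ⟨hm, he, ih⟩ <;>
      rcases (show c = i ∨ c = j from hc) with rfl | rfl
    · refine ⟨e + 1, .inr ⟨hm.add_one, he.add_one, ?_⟩⟩
      rw [h1, walk_val, ih, Simplex.permute_mul]; rfl
    · refine ⟨e - 1, .inr ⟨hm.add_one, he.sub_odd odd_one, ?_⟩⟩
      rw [h2, walk_inv_val, ih, Simplex.permute_mul]; rfl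
    · refine ⟨e - 1, .inl ⟨hm.add_one, he.sub_odd odd_one, ?_⟩⟩
      rw [h2, walk_inv_val, ih, Simplex.permute_mul]; rfl
    · refine ⟨e + 1, .inl ⟨hm.add_one, he.add_one, ?_⟩⟩
      rw [h1, walk_val, ih, Simplex.permute_mul]; rfl

/-- The walk around a face of codimension two is a chain of facet crossings. -/
theorem exists_chain_of_walk_pow {σ : S} {i j : Fin (n + 1)} (hij : i ≠ j) (x : Simplex n) (m : ℕ) :
    ∃ σ' w, T.Chain {i, j} σ m σ' w ∧
      ((Even m ∧ ((T.walk ^ m) ⟨(⟨σ, x⟩, i, j), hij⟩).1 = (⟨σ', x.permute w⟩, w i, w j)) ∨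
      (Odd m ∧ ((T.walk ^ m) ⟨(⟨σ, x⟩, i, j), hij⟩).1 = (⟨σ', x.permute w⟩, w j, w i))) := by
  induction m with
  | zero => exact ⟨σ, 1, .nil, .inl ⟨Even.zero, rfl⟩⟩
  | succ m ih =>
    obtain ⟨σ', w, h, ⟨hm, ih⟩ | ⟨hm, ih⟩⟩ := ih
    · refine ⟨_, _, h.step (c := i) (by simp), .inr ⟨hm.add_one, ?_⟩⟩
      rw [pow_succ', Equiv.Perm.mul_apply, walk_val, ih, Simplex.permute_mul]; rfl
    · refine ⟨_, _, h.step (c := j) (by simp), .inl ⟨hm.add_one, ?_⟩⟩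
      rw [pow_succ', Equiv.Perm.mul_apply, walk_val, ih, Simplex.permute_mul]; rfl

/-- A closed chain around a face of codimension two preserves the order of its two facets if and
only if it has even length. -/
theorem Chain.loop_apply {σ : S} {i j : Fin (n + 1)} (hij : i ≠ j) {x : Simplex n}
    {m : ℕ} {w : Equiv.Perm (Fin (n + 1))} (h : T.Chain {i, j} σ m σ w) (hx : zeros x = {i, j})
    (hw : x.permute w = x) :
    (Even m ∧ w i = i ∧ w j = j) ∨ (Odd m ∧ w i = j ∧ w j = i) := by
  have hz : w '' {i, j} = {i, j} := by rw [← hx, ← zeros_permute, hw]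
  have hi : w i = i ∨ w i = j := by
    have : w i ∈ ({i, j} : Set _) := hz ▸ ⟨i, by simp, rfl⟩
    simpa using this
  have hj : w j = i ∨ w j = j := by
    have : w j ∈ ({i, j} : Set _) := hz ▸ ⟨j, by simp, rfl⟩
    simpa using this
  have hne : w i ≠ w j := fun h => hij (w.injective h)
  -- The wrong combination of parity and order would make a power of the walk act at the flag like a
  -- turn.
  obtain ⟨e, ⟨hm, _, he⟩ | ⟨hm, _, he⟩⟩ := h.exists_walk_zpow hij x
  · refine .inl ⟨hm, ?_⟩
    rcases hi with hi | hi <;> rcases hj with hj | hj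
    · exact absurd (hi.trans hj.symm) hne
    · exact ⟨hi, hj⟩
    · rw [hi, hj, hw] at he
      exact absurd (Subtype.ext he) (T.walk_zpow_ne_turn e ⟨(⟨σ, x⟩, i, j), hij⟩)
    · exact absurd (hi.trans hj.symm) hne
  · refine .inr ⟨hm, ?_⟩
    rcases hi with hi | hi <;> rcases hj with hj | hj
    · exact absurd (hi.trans hj.symm) hne
    · rw [hi, hj, hw] at he
      exact absurd (Subtype.ext he) (T.walk_zpow_ne_turn e ⟨(⟨σ, x⟩, i, j), hij⟩)
    · exact ⟨hi, hj⟩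
    · exact absurd (hi.trans hj.symm) hne

/-- The number of points over a point of a face of codimension two is the period of the walk. -/
theorem fibreCard_eq_minimalPeriod {σ : S} {i j : Fin (n + 1)} (hij : i ≠ j) {x : Simplex n}
    (hx : zeros x = {i, j}) :
    T.fibreCard (T.proj ⟨σ, x⟩) =
      Function.minimalPeriod (T.walk • ·) (⟨(⟨σ, x⟩, i, j), hij⟩ : T.Flag) := by
  set f : T.Flag := ⟨(⟨σ, x⟩, i, j), hij⟩ with hf
  have hstep : ∀ g : T.Flag, zeros g.1.1.2 = {g.1.2.1, g.1.2.2} →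
      T.proj (T.walk g).1.1 = T.proj g.1.1 ∧
        zeros (T.walk g).1.1.2 = {(T.walk g).1.2.1, (T.walk g).1.2.2} := fun g hg => by
    constructor
    · have h0 : g.1.2.1 ∈ zeros g.1.1.2 := by rw [hg]; simp
      exact (Quot.sound ⟨g.1.2.1, h0, rfl, fun j => by simp [walk_val]⟩ :
        T.proj g.1.1 = T.proj (T.walk g).1.1).symm
    · rw [walk_val, zeros_permute, hg, Set.image_pair, Set.pair_comm]
  have hstep' : ∀ g : T.Flag, zeros g.1.1.2 = {g.1.2.1, g.1.2.2} →
      T.proj (T.walk⁻¹ g).1.1 = T.proj g.1.1 ∧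
        zeros (T.walk⁻¹ g).1.1.2 = {(T.walk⁻¹ g).1.2.1, (T.walk⁻¹ g).1.2.2} := fun g hg => by
    constructor
    · have h0 : g.1.2.2 ∈ zeros g.1.1.2 := by rw [hg]; simp
      exact (Quot.sound ⟨g.1.2.2, h0, rfl, fun j => by rw [walk_inv_val]; simp⟩ :
        T.proj g.1.1 = T.proj (T.walk⁻¹ g).1.1).symm
    · rw [walk_inv_val, zeros_permute, hg, Set.image_pair, Set.pair_comm]
  have horbit : ∀ e : ℤ, T.proj ((T.walk ^ e) f).1.1 = T.proj ⟨σ, x⟩ ∧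
      zeros ((T.walk ^ e) f).1.1.2 =
        {((T.walk ^ e) f).1.2.1, ((T.walk ^ e) f).1.2.2} := fun e => by
    induction e with
    | zero => exact ⟨rfl, hx⟩
    | succ e ih =>
      have := hstep _ ih.2
      rw [← Equiv.Perm.mul_apply, ← zpow_one_add, add_comm 1 (e : ℤ)] at this
      exact ⟨this.1.trans ih.1, this.2⟩
    | pred e ih =>
      have := hstep' _ ih.2
      rw [← Equiv.Perm.mul_apply, ← zpow_neg_one, ← zpow_add, ← sub_eq_neg_add] at this
      exact ⟨this.1.trans ih.1, this.2⟩
  have hset : T.proj ⁻¹' {T.proj ⟨σ, x⟩} =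
      (fun g : T.Flag => g.1.1) '' MulAction.orbit (Subgroup.zpowers T.walk) f := by
    ext ⟨σ', x'⟩
    simp only [Set.mem_preimage, Set.mem_singleton_iff, Set.mem_image]
    constructor
    · intro h
      obtain ⟨m, w, hc, rfl⟩ := proj_eq_iff.1 h.symm
      rw [hx] at hc
      obtain ⟨e, ⟨_, _, he⟩ | ⟨_, _, he⟩⟩ := hc.exists_walk_zpow hij x <;>
      exact ⟨_, ⟨⟨T.walk ^ e, e, rfl⟩, rfl⟩, congrArg Prod.fst he⟩
    · rintro ⟨_, ⟨⟨_, e, rfl⟩, rfl⟩, he⟩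
      rw [← he]
      exact (horbit e).1
  -- Over a given point there are only two flags made of its two facets, and they differ by a turn;
  -- the orbit cannot contain both.
  have hinj : Set.InjOn (fun g : T.Flag => g.1.1)
      (MulAction.orbit (Subgroup.zpowers T.walk) f) := by
    rintro _ ⟨⟨_, e, rfl⟩, rfl⟩ _ ⟨⟨_, e', rfl⟩, rfl⟩ h
    change ((T.walk ^ e) f).1.1 = ((T.walk ^ e') f).1.1 at h
    change (T.walk ^ e) f = (T.walk ^ e') f
    have h1 := (horbit e).2
    rw [h, (horbit e').2, Set.pair_eq_pair_iff] at h1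
    rcases h1 with h1 | h1
    · exact Subtype.ext (Prod.ext h (Prod.ext h1.1.symm h1.2.symm))
    · exfalso
      apply T.walk_zpow_ne_turn (e - e') ((T.walk ^ e') f)
      rw [← Equiv.Perm.mul_apply, ← zpow_add, sub_add_cancel]
      exact Subtype.ext (Prod.ext h (Prod.ext h1.2.symm h1.1.symm))
  -- For an infinite orbit both sides take the value `0`.
  rw [fibreCard, hset, hinj.ncard_image, ← Nat.card_coe_set_eq,
    Nat.card_congr (MulAction.orbitZPowersEquiv T.walk f), Nat.card_zmod]

end Triangulation

/-! ### Gaps between coordinates and small displacements. -/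

theorem exists_pos_le_abs_sub {ι : Type*} [Finite ι] (y : ι → ℝ) :
    ∃ ε > 0, ∀ p q, y p ≠ y q → ε ≤ |y p - y q| := by
  have h : ∀ᶠ ε in 𝓝[>] (0 : ℝ), ∀ p q, y p ≠ y q → ε ≤ |y p - y q| := by
    rw [Filter.eventually_all]; intro p
    rw [Filter.eventually_all]; intro q
    by_cases hpq : y p = y q
    · simp [hpq]
    · filter_upwards [Ioo_mem_nhdsGT (abs_pos.2 (sub_ne_zero.2 hpq))] with ε hε _ using hε.2.le
  obtain ⟨ε, h1, h2⟩ := (h.and self_mem_nhdsWithin).exists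
  exact ⟨ε, h2, h1⟩

/-- A lower bound for the nonzero coordinates of a point and for their nonzero differences. -/
theorem Simplex.exists_gap {n : ℕ} (x : Simplex n) :
    ∃ ε > 0, (∀ l, x l ≠ 0 → ε ≤ x l) ∧ ∀ p q, x p ≠ x q → ε ≤ |x p - x q| := by
  -- The additional value `0` at `none` makes the same bound apply to the nonzero coordinates
  -- themselves.
  obtain ⟨ε, hε, h⟩ := exists_pos_le_abs_sub (fun o : Option (Fin (n + 1)) => o.elim 0 fun l => x l)
  refine ⟨ε, hε, fun l hl => ?_, fun p q => h (some p) (some q)⟩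
  have := h (some l) none hl
  simpa [abs_of_nonneg (x.2.1 l)] using (this : ε ≤ |x l - 0|).trans_eq
    ((congrArg _ (sub_zero _)).trans (abs_of_nonneg (x.2.1 l)))

theorem Simplex.dist_lt_iff {n : ℕ} {x y : Simplex n} {ε : ℝ} (hε : 0 < ε) :
    dist x y < ε ↔ ∀ l, |x l - y l| < ε :=
  dist_pi_lt_iff (f := (x : Fin (n + 1) → ℝ)) (g := y) hε

theorem Simplex.dist_permute_lt_iff {n : ℕ} {x y : Simplex n} {ε : ℝ} (hε : 0 < ε)
    (w : Equiv.Perm (Fin (n + 1))) :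
    dist (x.permute w) (y.permute w) < ε ↔ dist x y < ε := by
  rw [dist_lt_iff hε, dist_lt_iff hε]
  exact ⟨fun h l => by simpa using h (w l), fun h l => h (w.symm l)⟩

/-- Moving the weight `t` from the corner `q` to the corner `p`. -/
def Simplex.shift {n : ℕ} (x : Simplex n) (p q : Fin (n + 1)) (t : ℝ) (ht : 0 ≤ t)
    (hq : t ≤ x q) : Simplex n :=
  ⟨fun l => x l + (if l = p then t else 0) - (if l = q then t else 0), fun l => by
    have := x.2.1 l
    change 0 ≤ x l at this
    dsimp only
    split_ifs with h1 h2 h2 <;> subst_vars <;> linarith, by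
    rw [Finset.sum_sub_distrib, Finset.sum_add_distrib]
    simp⟩

theorem Simplex.shift_apply {n : ℕ} (x : Simplex n) (p q : Fin (n + 1)) (t : ℝ) (ht : 0 ≤ t)
    (hq : t ≤ x q) (l : Fin (n + 1)) : x.shift p q t ht hq l =
      x l + (if l = p then t else 0) - (if l = q then t else 0) := rfl

theorem Simplex.dist_shift_lt {n : ℕ} (x : Simplex n) (p q : Fin (n + 1)) {t ε : ℝ} (ht : 0 ≤ t)
    (hq : t ≤ x q) (hε : t < ε) : dist (x.shift p q t ht hq) x < ε := by
  rw [Simplex.dist_lt_iff (ht.trans_lt hε)]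
  intro l
  rw [Simplex.shift_apply, abs_lt]
  split_ifs <;> constructor <;> linarith

theorem support_permute {n : ℕ} (w : Equiv.Perm (Fin (n + 1))) (x : Simplex n) :
    support (x.permute w) = (support x).map w.toEmbedding := by
  ext l
  simp [mem_support, Finset.mem_map_equiv]

/-! ### Regular points and the holonomy around them. -/

namespace Triangulation

variable {n : ℕ} {S : Type*} {T : Triangulation n S}

theorem IsFree.apply_eq_self {σ : S} {x : Simplex n} (hf : T.IsFree ⟨σ, x⟩) {m : ℕ}
    {w : Equiv.Perm (Fin (n + 1))} (h : T.Chain (zeros x) σ m σ w) (hw : x.permute w = x)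
    {l : Fin (n + 1)} (hl : x l ≠ 0) : w l = l := by
  by_contra hne
  obtain ⟨V, hV, hV'⟩ := hf
  obtain ⟨ε, hε, hεV⟩ := Metric.mem_nhds_iff.1 hV
  have hwl : x (w l) = x l := by
    conv_lhs => rw [← hw]
    simp
  have hpos : 0 < x l := lt_of_le_of_ne (x.2.1 l) hl.symm
  obtain ⟨t, ht0, ht⟩ := exists_between (lt_min hε hpos)
  have htε := ht.trans_le (min_le_left _ _)
  have htx := ht.trans_le (min_le_right _ _)
  -- Since `x l = x (w l)`, the shift by `t < x l` stays on the open face but makes these two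
  -- coordinates differ. Then `y` and `y.permute w` are distinct points near `x` with the same
  -- image.
  set y := x.shift l (w l) t ht0.le (by rw [hwl]; exact htx.le) with hy
  have hzy : zeros y = zeros x := by
    ext r
    simp only [mem_zeros, hy, Simplex.shift_apply]
    split_ifs with h1 h2 h2
    · exact absurd (h2.symm.trans h1) hne
    · subst h1; constructor <;> intro <;> linarith
    · subst h2; rw [hwl]; constructor <;> intro <;> linarith
    · simp
  have hdy : dist y x < ε := Simplex.dist_shift_lt _ _ _ _ _ htε
  have hdz : dist (y.permute w) x < ε := by
    conv_lhs => rw [← hw]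
    rwa [Simplex.dist_permute_lt_iff hε]
  have hzz : zeros (y.permute w) = zeros x := by
    rw [zeros_permute, hzy, ← zeros_permute, hw]
  have := hV' y (hεV hdy) (y.permute w) (hεV hdz) (support_eq_support_iff.2 hzy)
    (support_eq_support_iff.2 hzz) (hzy ▸ h : T.Chain (zeros y) σ m σ w).proj_eq
  have h1 : y (w l) = y l := by
    conv_lhs => rw [this]
    simp
  rw [hy, Simplex.shift_apply, Simplex.shift_apply, if_neg hne, if_pos rfl, if_pos rfl,
    if_neg (Ne.symm hne), hwl] at h1
  linarith

/-- If points close to `x` on its open face are related by `w`, then `w` moves each coordinate of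
`x` by less than the gap between distinct coordinates, so it fixes `x`. -/
theorem isFree_of_loops {σ : S} {x : Simplex n}
    (h : ∀ m w, T.Chain (zeros x) σ m σ w → x.permute w = x → ∀ l, x l ≠ 0 → w l = l) :
    T.IsFree ⟨σ, x⟩ := by
  obtain ⟨ε, hε, -, hgap⟩ := x.exists_gap
  refine ⟨Metric.ball x (ε / 2), Metric.ball_mem_nhds x (half_pos hε), ?_⟩
  intro y hy z hz hsy _ hyz
  obtain ⟨m, w, hc, rfl⟩ := proj_eq_iff.1 hyz
  have hzy : zeros y = zeros x := support_eq_support_iff.1 hsy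
  rw [Metric.mem_ball, Simplex.dist_lt_iff (half_pos hε)] at hy hz
  have hw : x.permute w = x := by
    refine Simplex.ext fun l => ?_
    by_contra hne
    have h1 := hgap _ _ hne
    have h2 := hy (w.symm l)
    have h3 := hz l
    rw [abs_lt] at h2 h3
    rw [Simplex.permute_apply] at h3
    rw [le_abs] at h1
    rcases h1 with h1 | h1 <;> linarith
  rw [hzy] at hc
  have hl := h m w hc hw
  refine Simplex.ext fun l => ?_
  rw [Simplex.permute_apply]
  by_cases h0 : x (w.symm l) = 0
  · have h1 : x l = 0 := by
      have h2 := congrArg (fun z : Simplex n => z l) hw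
      exact h2.symm.trans h0
    rw [← mem_zeros, ← hzy] at h0 h1
    exact h1.trans h0.symm
  · have := hl _ h0
    rw [Equiv.apply_symm_apply] at this
    rw [← this]

/-- A chain from `a` to `b` conjugates the closed chains at `b` into closed chains at `a`. -/
theorem IsFree.of_proj_eq {a b : T.Delta} (ha : T.IsFree a) (h : T.proj a = T.proj b) :
    T.IsFree b := by
  obtain ⟨σ, x⟩ := a
  obtain ⟨σ', x'⟩ := b
  obtain ⟨m, u, hu, rfl⟩ := proj_eq_iff.1 h
  refine isFree_of_loops fun m' w hw hwx l hl => ?_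
  rw [zeros_permute] at hw
  have himg : (w * u : Equiv.Perm (Fin (n + 1))) '' zeros x = u '' zeros x := by
    rw [← zeros_permute, Simplex.permute_mul, hwx, zeros_permute]
  have h1 := (hu.trans hw).trans (himg ▸ hu.symm)
  have h2 : x.permute (u⁻¹ * (w * u)) = x := by
    rw [Simplex.permute_mul, Simplex.permute_mul, hwx, ← Simplex.permute_mul, inv_mul_cancel,
      Simplex.permute_one]
  have h3 := ha.apply_eq_self h1 h2 (l := u.symm l) hl
  simpa [Equiv.symm_apply_eq] using h3

theorem card_support_eq_of_proj_eq {a b : T.Delta} (h : T.proj a = T.proj b) :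
    (support b.2).card = (support a.2).card := by
  obtain ⟨m, u, hu, hx⟩ := proj_eq_iff.1 h
  rw [hx, support_permute, Finset.card_map]

theorem isRegular_of_isFree (hn : 3 ≤ n) {a : T.Delta} (ha : T.IsFree a)
    (hs : n - 1 ≤ (support a.2).card) : T.IsRegular (T.proj a) := by
  refine ⟨?_, fun b hb => ha.of_proj_eq hb.symm⟩
  rintro ⟨b, hb, hba⟩
  have := card_support_eq_of_proj_eq hba
  simp only [Set.mem_ofPred_eq] at hb
  omega

theorem IsRegular.le_card_support (hn : 3 ≤ n) {a : T.Delta} (h : T.IsRegular (T.proj a)) :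
    n - 1 ≤ (support a.2).card := by
  by_contra hlt
  refine h.1 ⟨a, ?_, rfl⟩
  simp only [Set.mem_ofPred_eq]
  omega

theorem Chain.eq_of_empty {σ σ' : S} {m : ℕ} {w : Equiv.Perm (Fin (n + 1))}
    (h : T.Chain ∅ σ m σ' w) : w = 1 := by
  cases h with
  | nil => rfl
  | step _ hc => exact absurd hc (Set.notMem_empty _)

theorem Chain.eq_of_singleton {σ σ' : S} {i : Fin (n + 1)} {m : ℕ} {w : Equiv.Perm (Fin (n + 1))}
    (h : T.Chain {i} σ m σ' w) : (σ' = σ ∧ w = 1) ∨ (σ' = T.nbr σ i ∧ w = T.perm σ i) := by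
  induction h with
  | nil => exact .inl ⟨rfl, rfl⟩
  | step h hc ih =>
    obtain rfl : _ = i := hc
    rcases ih with ⟨rfl, rfl⟩ | ⟨rfl, rfl⟩
    · right; simp
    · left; rw [T.nbr_nbr, T.perm_nbr]; simp

theorem exists_zeros_eq {x : Simplex n} (h : n - 1 ≤ (support x).card) (hn : 1 ≤ n) :
    zeros x = ∅ ∨ (∃ i, zeros x = {i}) ∨
      (support x).card = n - 1 ∧ ∃ i j, i ≠ j ∧ zeros x = {i, j} := by
  have hz : zeros x = ((support x)ᶜ : Finset (Fin (n + 1))) := by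
    ext l; simp [mem_support, mem_zeros]
  have hc := Finset.card_add_card_compl (support x)
  rw [Fintype.card_fin] at hc
  rw [hz]
  obtain h0 | h0 | h0 : (support x)ᶜ.card = 0 ∨ (support x)ᶜ.card = 1 ∨ (support x)ᶜ.card = 2 := by
    omega
  · left; rw [Finset.card_eq_zero.1 h0]; simp
  · right; left
    obtain ⟨i, hi⟩ := Finset.card_eq_one.1 h0
    exact ⟨i, by rw [hi]; simp⟩
  · right; right
    obtain ⟨i, j, hij, hi⟩ := Finset.card_eq_two.1 h0
    exact ⟨by omega, i, j, hij, by rw [hi]; simp⟩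

/-- In an even triangulation, the holonomy around a regular point is trivial. -/
theorem IsEven.loop_eq_one (hE : T.IsEven) (hn : 3 ≤ n) {σ : S} {x : Simplex n}
    (hr : T.IsRegular (T.proj ⟨σ, x⟩)) {m : ℕ} {w : Equiv.Perm (Fin (n + 1))}
    (h : T.Chain (zeros x) σ m σ w) (hw : x.permute w = x) : w = 1 := by
  obtain h0 | ⟨i, hi⟩ | ⟨hcard, i, j, hij, hz⟩ := exists_zeros_eq (hr.le_card_support hn) (by omega)
  · exact (h0 ▸ h).eq_of_empty
  · obtain ⟨-, h1⟩ | ⟨h1, h2⟩ := (hi ▸ h : T.Chain {i} σ m σ w).eq_of_singleton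
    · exact h1
    · exfalso
      have h3 : w '' {i} = {i} := by rw [← hi, ← zeros_permute, hw]
      rw [Set.image_singleton, Set.singleton_eq_singleton_iff] at h3
      exact T.ne_self σ i (by rw [← h1, ← h2, h3])
  · have h' : T.Chain {i, j} σ m σ w := hz ▸ h
    have hd := hE ⟨σ, x⟩ hcard hr
    rw [fibreCard_eq_minimalPeriod hij hz] at hd
    have hfix : ∀ l, x l ≠ 0 → w l = l := fun l hl => (hr.2 _ rfl).apply_eq_self h hw hl
    obtain ⟨hm, h1, h2⟩ | ⟨hm, h1, h2⟩ := h'.loop_apply hij hz hw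
    · ext l
      by_cases hl : x l = 0
      · have : l ∈ ({i, j} : Set _) := hz ▸ hl
        rcases this with rfl | hlj
        · rw [h1]; rfl
        · obtain rfl : l = j := hlj
          rw [h2]; rfl
      · rw [hfix l hl]; rfl
    · exfalso
      -- An exchange of the facets would return the walk to its initial flag after an odd number `e`
      -- of steps, but the even period divides `e`.
      obtain ⟨e, ⟨hm', _, he⟩ | ⟨_, he', he⟩⟩ := h'.exists_walk_zpow hij x
      · exact (Nat.not_even_iff_odd.2 hm) hm'
      · rw [h1, h2, hw] at he
        have := MulAction.zpow_smul_eq_iff_minimalPeriod_dvd.1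
          (Subtype.ext he : T.walk ^ e • (⟨(⟨σ, x⟩, i, j), hij⟩ : T.Flag) = _)
        exact (Int.not_even_iff_odd.2 he') (even_iff_two_dvd.2
          (dvd_trans (by exact_mod_cast even_iff_two_dvd.1 hd) this))

/-- Around a regular point of a face of codimension two of odd degree, there is a closed chain that
exchanges the two facets and fixes the other corners. -/
theorem exists_chain_swap_of_odd {σ : S} {x : Simplex n} {i j : Fin (n + 1)} (hij : i ≠ j)
    (hz : zeros x = {i, j}) (hf : T.IsFree ⟨σ, x⟩)
    (hodd : Odd (T.fibreCard (T.proj ⟨σ, x⟩))) :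
    ∃ m, T.Chain {i, j} σ m σ (Equiv.swap i j) := by
  rw [fibreCard_eq_minimalPeriod hij hz] at hodd
  obtain ⟨σ', w, h, ⟨he, -⟩ | ⟨-, hw⟩⟩ := exists_chain_of_walk_pow (T := T) (σ := σ) hij x
    (Function.minimalPeriod (T.walk • ·) (⟨(⟨σ, x⟩, i, j), hij⟩ : T.Flag))
  · exact absurd he (Nat.not_even_iff_odd.2 hodd)
  -- One full period closes up the flag; as its length is odd, the final flag reads `(w j, w i)`, so
  -- `w` exchanges `i` and `j`.
  · have h1 := MulAction.pow_smul_eq_iff_minimalPeriod_dvd.2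
      (dvd_refl (Function.minimalPeriod (T.walk • ·) (⟨(⟨σ, x⟩, i, j), hij⟩ : T.Flag)))
    rw [Equiv.Perm.smul_def] at h1
    rw [h1] at hw
    simp only [Prod.mk.injEq, Sigma.mk.injEq] at hw
    obtain ⟨⟨rfl, h2⟩, h3, h4⟩ := hw
    have h2 := (eq_of_heq h2).symm
    have h5 := h
    rw [← hz] at h5
    suffices hs : Equiv.swap i j = w from ⟨_, hs ▸ h⟩
    ext l
    congr 1
    by_cases hl : x l = 0
    · have : l ∈ ({i, j} : Set _) := hz ▸ hl
      rcases this with rfl | hlj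
      · rw [← h4, Equiv.swap_apply_left]
      · obtain rfl : l = j := hlj
        rw [← h3, Equiv.swap_apply_right]
    · rw [hf.apply_eq_self h5 h2 hl, Equiv.swap_apply_of_ne_of_ne]
      · rintro rfl; exact hl (mem_zeros.1 (hz ▸ by simp))
      · rintro rfl; exact hl (mem_zeros.1 (hz ▸ by simp))


/-! ### Even triangulations give immersions. -/

/-- The points within `r` of a point in the fibre over `h`, in the same disc. -/
def discNhd (T : Triangulation n S) {k : ℕ} (h : T.Hypersurface k) (r : ℝ) : Set (T.Discs k) :=
  {b | ∃ (x' : Simplex n) (hx' : x' ∈ disc b.1.2),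
    Quot.mk (T.DiscGlue k) ⟨b.1, x', hx'⟩ = h ∧ dist b.2.1 x' < r}

theorem isOpen_discNhd {k : ℕ} (h : T.Hypersurface k) (r : ℝ) : IsOpen (T.discNhd h r) := by
  rw [isOpen_sigma_iff]
  intro p
  have : Sigma.mk p ⁻¹' T.discNhd h r = ⋃ (x' : Simplex n) (hx' : x' ∈ disc p.2)
      (_ : Quot.mk (T.DiscGlue k) ⟨p, x', hx'⟩ = h),
      (Subtype.val ⁻¹' Metric.ball x' r : Set (disc p.2)) := by
    ext y
    simp [discNhd]
  rw [this]
  exact isOpen_iUnion fun _ => isOpen_iUnion fun _ => isOpen_iUnion fun _ =>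
    Metric.isOpen_ball.preimage continuous_subtype_val

/-- All points of a fibre have the same coordinates up to a permutation. -/
theorem exists_permute_of_discs_mk_eq {k : ℕ} {p q : S × DiscType n k} {x x' : Simplex n}
    {hx : x ∈ disc p.2} {hx' : x' ∈ disc q.2}
    (h : Quot.mk (T.DiscGlue k) ⟨q, x', hx'⟩ = Quot.mk (T.DiscGlue k) ⟨p, x, hx⟩) :
    ∃ u, x' = x.permute u := by
  obtain ⟨_, u, _, _, hu⟩ := chain_of_discs_mk_eq h.symm
  exact ⟨u, hu⟩

theorem zeros_subset_of_dist_lt {x x' y : Simplex n} {ε : ℝ} (hε : 0 < ε)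
    (hx : ∀ l, x l ≠ 0 → ε ≤ x l) {u : Equiv.Perm (Fin (n + 1))} (hu : x' = x.permute u)
    (hy : dist y x' < ε / 2) : zeros y ⊆ zeros x' := by
  intro l hl
  by_contra hne
  rw [hu] at hne
  have h1 := hx _ hne
  have h2 := (Simplex.dist_lt_iff (half_pos hε)).1 hy l
  rw [mem_zeros.1 hl, hu, Simplex.permute_apply, abs_lt] at h2
  linarith

/-- Below half the least nonzero coordinate, a nearby point lies only in facets that also contain
the centre. The gluing thus carries the centre along, and being isometric it keeps the distance. So
the neighbourhood is saturated and its image is open. -/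
theorem discNhd_of_glue {k : ℕ} {p : S × DiscType n k} {x : Simplex n} {hx : x ∈ disc p.2}
    {ε : ℝ} (hε : 0 < ε) (hgap : ∀ l, x l ≠ 0 → ε ≤ x l) {b c : T.Discs k}
    (hb : b ∈ T.discNhd (Quot.mk (T.DiscGlue k) ⟨p, x, hx⟩) (ε / 2)) (hbc : T.DiscGlue k b c) :
    c ∈ T.discNhd (Quot.mk (T.DiscGlue k) ⟨p, x, hx⟩) (ε / 2) := by
  obtain ⟨⟨σ, ν⟩, y, hy⟩ := b
  obtain ⟨⟨τ, μ⟩, z, hz⟩ := c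
  obtain ⟨x', hx', h1, h2⟩ := hb
  obtain ⟨i, hi, h3, h4⟩ := hbc
  simp only [Prod.mk.injEq] at *
  obtain ⟨rfl, rfl⟩ := h3
  obtain ⟨u, hu⟩ := exists_permute_of_discs_mk_eq h1
  refine ⟨x'.permute (T.perm σ i), permute_mem_disc hx' _, ?_, ?_⟩
  · rw [← h1]
    symm
    exact Quot.sound ⟨i, zeros_subset_of_dist_lt hε hgap hu h2 hi, rfl, fun j => by simp⟩
  · have : z = y.permute (T.perm σ i) := Simplex.ext fun l => by
      rw [Simplex.permute_apply, ← h4, Equiv.apply_symm_apply]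
    dsimp only
    rw [this, Simplex.dist_permute_lt_iff (half_pos hε)]
    exact h2

theorem image_discNhd_mem_nhds {k : ℕ} {p : S × DiscType n k} {x : Simplex n} {hx : x ∈ disc p.2}
    {ε : ℝ} (hε : 0 < ε) (hgap : ∀ l, x l ≠ 0 → ε ≤ x l) :
    Quot.mk (T.DiscGlue k) '' T.discNhd (Quot.mk (T.DiscGlue k) ⟨p, x, hx⟩) (ε / 2) ∈
      𝓝 (Quot.mk (T.DiscGlue k) ⟨p, x, hx⟩ : T.Hypersurface k) := by
  have hmem : (⟨p, x, hx⟩ : T.Discs k) ∈ T.discNhd (Quot.mk (T.DiscGlue k) ⟨p, x, hx⟩) (ε / 2) :=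
    ⟨x, hx, rfl, by rw [dist_self]; exact half_pos hε⟩
  refine IsOpen.mem_nhds ?_ (Set.mem_image_of_mem _ hmem)
  refine (isQuotientMap_quot_mk (r := T.DiscGlue k)).isOpen_preimage.1 ?_
  convert isOpen_discNhd (T := T) (Quot.mk (T.DiscGlue k) ⟨p, x, hx⟩) (ε / 2)
  refine Set.Subset.antisymm ?_ (Set.subset_preimage_image _ _)
  rintro c ⟨b, hb, hbc⟩
  have := reflTransGen_of_mk_eq (fun _ _ => discGlue_symm) hbc
  clear hbc
  induction this with
  | refl => exact hb
  | tail _ h ih => exact discNhd_of_glue hε hgap ih h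

/-- A chain relating two nearby points with the same image also relates their centres, which are one
point of the hypersurface. The disc types could then differ only by holonomy, which is trivial. -/
theorem IsEven.hypersurfaceIsImmersion (hE : T.IsEven) (hn : 3 ≤ n) (k : ℕ) :
    T.HypersurfaceIsImmersion k := by
  intro h
  induction h using Quot.ind with | mk a =>
  obtain ⟨p, x, hx⟩ := a
  intro hr
  change T.IsRegular (T.proj ⟨p.1, x⟩) at hr
  obtain ⟨ε, hε, hgap0, hgap⟩ := x.exists_gap
  refine ⟨_, image_discNhd_mem_nhds hε hgap0, ?_⟩
  rintro _ ⟨⟨⟨σ₁, ν₁⟩, y₁, hy₁⟩, ⟨x₁, hx₁, hq₁, hd₁⟩, rfl⟩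
    _ ⟨⟨⟨σ₂, ν₂⟩, y₂, hy₂⟩, ⟨x₂, hx₂, hq₂, hd₂⟩, rfl⟩ hf
  change T.proj ⟨σ₁, y₁⟩ = T.proj ⟨σ₂, y₂⟩ at hf
  dsimp only at *
  obtain ⟨m, w, hc, rfl⟩ := proj_eq_iff.1 hf
  obtain ⟨u₁, hu₁⟩ := exists_permute_of_discs_mk_eq hq₁
  obtain ⟨u₂, hu₂⟩ := exists_permute_of_discs_mk_eq hq₂
  have hc' : T.Chain (zeros x₁) σ₁ m σ₂ w := hc.mono (zeros_subset_of_dist_lt hε hgap0 hu₁ hd₁)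
  -- Both centres have the coordinates of `x` in some order and lie within `ε / 2` of the same
  -- point, so no coordinate can differ by the gap `ε`.
  have hx₂' : x₂ = x₁.permute w := by
    refine Simplex.ext fun l => ?_
    by_contra hne
    rw [← Simplex.dist_permute_lt_iff (half_pos hε) w, Simplex.dist_lt_iff (half_pos hε)] at hd₁
    rw [Simplex.dist_lt_iff (half_pos hε)] at hd₂
    have h1 := hd₁ l
    have h2 := hd₂ l
    rw [hu₁] at hne h1
    rw [hu₂] at hne h2
    have h3 := hgap _ _ hne
    rw [abs_lt] at h1 h2
    simp only [Simplex.permute_apply] at h1 h2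
    rw [le_abs] at h3
    rcases h3 with h3 | h3 <;> linarith
  subst hx₂'
  have hq := (hc'.discs_mk_eq hx₁).symm.trans (hq₁.trans hq₂.symm)
  obtain ⟨m', w', hc'', hν, hw'⟩ := chain_of_discs_mk_eq hq
  have hproj : T.proj ⟨p.1, x⟩ = T.proj ⟨σ₂, x₁.permute w⟩ :=
    (congrArg (T.hypersurfaceMap k) hq₂).symm
  have hw1 : w' = 1 := hE.loop_eq_one hn (hproj ▸ hr) hc'' hw'.symm
  rw [hw1, DiscType.map_one] at hν
  rw [hc.discs_mk_eq hy₁]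
  exact discs_mk_congr σ₂ hν.symm rfl

end Triangulation

/-! ### Generic points on a disc that separates two corners. -/

theorem exists_card_eq_mem_notMem {n k : ℕ} (hk : 1 < k) (hkn : 2 * k ≤ n + 1)
    {i j : Fin (n + 1)} (hij : i ≠ j) :
    ∃ A : Finset (Fin (n + 1)), A.card = k ∧ i ∈ A ∧ j ∉ A := by
  obtain ⟨A, h1, h2, h3⟩ := Finset.exists_subsuperset_card_eq (s := {i}) (t := {j}ᶜ) (n := k)
    (by simpa using hij.symm) (by simp; omega) (by rw [Finset.card_compl]; simp; omega)
  refine ⟨A, h3, h1 (by simp), fun h => ?_⟩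
  simpa using h2 h

/-- A point of the disc that separates `A` from its complement, on the open face opposite to `i`
and `j`, whose coordinates are distinct as far as this is possible. -/
theorem exists_generic_point {n : ℕ} {A : Finset (Fin (n + 1))} {i j p q : Fin (n + 1)}
    (hi : i ∈ A) (hj : j ∉ A) (hp : p ∈ A) (hpi : p ≠ i) (hq : q ∉ A) (hqj : q ≠ j) :
    ∃ x : Simplex n, zeros x = {i, j} ∧ ∑ l ∈ A, x l = 1 / 2 ∧
      ∀ l l', x l ≠ 0 → x l = x l' → l = l' ∨ n = 3 := by
  classical
  set P := (A.erase i).erase p with hP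
  set Q := (Aᶜ.erase j).erase q with hQ
  have hpA : p ∈ A.erase i := Finset.mem_erase.2 ⟨hpi, hp⟩
  have hqA : q ∈ Aᶜ.erase j := Finset.mem_erase.2 ⟨hqj, Finset.mem_compl.2 hq⟩
  have hjc : j ∈ Aᶜ := Finset.mem_compl.2 hj
  let s : Finset (Fin (n + 1)) → ℕ := fun B => ∑ l ∈ B.map Fin.valEmbedding, 2 ^ l
  have hs : ∀ B, (s B : ℝ) < 2 ^ (n + 1) := fun B => by
    have : s B < 2 ^ (n + 1) := Nat.geomSum_lt le_rfl (by
      intro l hl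
      obtain ⟨l, -, rfl⟩ := Finset.mem_map.1 hl
      exact l.2)
    exact_mod_cast this
  have hs' : ∀ B, (s B : ℝ) = ∑ l ∈ B, (2 : ℝ) ^ (l : ℕ) := fun B => by
    simp [s]
  -- Powers of two give distinct coordinates with distinct subset sums. This scale keeps all subset
  -- sums below `1 / 4`, so that the remainders placed at `p` and `q` exceed `1 / 4` and differ from
  -- the other coordinates.
  set δ : ℝ := (4 * 2 ^ (n + 1))⁻¹ with hδ
  have hδ0 : 0 < δ := by positivity
  have hδs : ∀ B, δ * s B < 1 / 4 := fun B => by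
    have h1 : δ * 2 ^ (n + 1) = 1 / 4 := by rw [hδ]; field_simp
    rw [← h1]
    exact mul_lt_mul_of_pos_left (hs B) hδ0
  have hδl : ∀ l : Fin (n + 1), δ * 2 ^ (l : ℕ) < 1 / 4 := fun l => by
    have := hδs {l}
    rwa [hs', Finset.sum_singleton] at this
  have hδl0 : ∀ l : Fin (n + 1), 0 < δ * 2 ^ (l : ℕ) := fun l => by positivity
  let f : Fin (n + 1) → ℝ := fun l => if l = i ∨ l = j then 0 else
    if l = p then 1 / 2 - δ * s P else if l = q then 1 / 2 - δ * s Q else δ * 2 ^ (l : ℕ)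
  have hpj : p ≠ j := fun h => hj (h ▸ hp)
  have hqi : q ≠ i := fun h => hq (h ▸ hi)
  have hqp : q ≠ p := fun h => hq (h ▸ hp)
  have fi : f i = 0 := by simp [f]
  have fj : f j = 0 := by simp [f]
  have fp : f p = 1 / 2 - δ * s P := by simp [f, hpi, hpj]
  have fq : f q = 1 / 2 - δ * s Q := by simp [f, hqi, hqj, hqp]
  have fl : ∀ l, l ≠ i → l ≠ j → l ≠ p → l ≠ q → f l = δ * 2 ^ (l : ℕ) := fun l h1 h2 h3 h4 => by
    simp only [f]; rw [if_neg (by tauto), if_neg h3, if_neg h4]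
  have hcases : ∀ l, (l = i ∨ l = j) ∨ (l = p ∨ l = q) ∨
      (l ≠ i ∧ l ≠ j ∧ l ≠ p ∧ l ≠ q) := fun l => by tauto
  have hA : ∑ l ∈ A, f l = 1 / 2 := by
    rw [← Finset.add_sum_erase _ _ hi, ← Finset.add_sum_erase _ _ hpA, fi, fp, hs', Finset.mul_sum]
    have : ∑ l ∈ P, f l = ∑ l ∈ P, δ * 2 ^ (l : ℕ) := Finset.sum_congr rfl fun l hl => by
      simp only [hP, Finset.mem_erase] at hl
      exact fl l hl.2.1 (fun h => hj (h ▸ hl.2.2)) hl.1 (fun h => hq (h ▸ hl.2.2))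
    rw [this]; ring
  have hAc : ∑ l ∈ Aᶜ, f l = 1 / 2 := by
    rw [← Finset.add_sum_erase _ _ hjc, ← Finset.add_sum_erase _ _ hqA, fj, fq, hs',
      Finset.mul_sum]
    have : ∑ l ∈ Q, f l = ∑ l ∈ Q, δ * 2 ^ (l : ℕ) := Finset.sum_congr rfl fun l hl => by
      simp only [hQ, Finset.mem_erase, Finset.mem_compl] at hl
      exact fl l (fun h => hl.2.2 (h ▸ hi)) hl.2.1 (fun h => hl.2.2 (h ▸ hp)) hl.1
    rw [this]; ring
  have hPs := hδs P
  have hQs := hδs Q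
  have hbig : ∀ l, l = p ∨ l = q → 1 / 4 < f l := by
    rintro l (rfl | rfl)
    · rw [fp]; linarith
    · rw [fq]; linarith
  have hpos : ∀ l, ¬ (l = i ∨ l = j) → 0 < f l := fun l hl => by
    rcases hcases l with h | h | ⟨h1, h2, h3, h4⟩
    · exact absurd h hl
    · linarith [hbig l h]
    · rw [fl l h1 h2 h3 h4]; exact hδl0 l
  have hzero : ∀ l, f l = 0 ↔ l = i ∨ l = j := fun l =>
    ⟨fun h => by_contra fun hl => (hpos l hl).ne' h, by rintro (rfl | rfl) <;> assumption⟩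
  have hpq : f p = f q → n = 3 := fun h => by
    rw [fp, fq] at h
    have h1 : (s P : ℝ) = s Q := mul_left_cancel₀ hδ0.ne' (by linarith)
    -- By uniqueness of binary expansions. As `P` and `Q` lie on opposite sides of the partition,
    -- both are empty, which leaves only the four corners `i`, `j`, `p`, `q`.
    have h2 : P = Q := Finset.map_injective _ (Finset.geomSum_injective le_rfl (by exact_mod_cast h1))
    have h3 : P = ∅ := by
      refine Finset.eq_empty_of_forall_notMem fun l hl => ?_
      have hl' := h2 ▸ hl
      simp only [hP, hQ, Finset.mem_erase, Finset.mem_compl] at hl hl'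
      exact hl'.2.2 hl.2.2
    have h4 : P.card = 0 := by rw [h3]; rfl
    have h5 : Q.card = 0 := by rw [← h2]; exact h4
    rw [hP, Finset.card_erase_of_mem hpA, Finset.card_erase_of_mem hi] at h4
    rw [hQ, Finset.card_erase_of_mem hqA, Finset.card_erase_of_mem hjc] at h5
    have h6 := Finset.card_add_card_compl A
    rw [Fintype.card_fin] at h6
    have h7 : 1 < A.card := Finset.one_lt_card.2 ⟨p, hp, i, hi, hpi⟩
    have h8 : 1 < Aᶜ.card := Finset.one_lt_card.2 ⟨q, Finset.mem_compl.2 hq, j, hjc, hqj⟩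
    omega
  refine ⟨⟨f, fun l => ?_, ?_⟩, ?_, hA, fun l l' h0 h => ?_⟩
  · by_cases h : l = i ∨ l = j
    · exact ((hzero l).2 h).ge
    · exact (hpos l h).le
  · rw [← Finset.sum_add_sum_compl A, hA, hAc]; norm_num
  · ext l; exact hzero l
  · change f l = f l' at h
    change f l ≠ 0 at h0
    have h0' : f l' ≠ 0 := h ▸ h0
    rw [Ne, hzero] at h0 h0'
    rcases hcases l with h1 | h1 | ⟨h1, h2, h3, h4⟩
    · exact absurd h1 h0
    · rcases hcases l' with h1' | h1' | ⟨h1', h2', h3', h4'⟩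
      · exact absurd h1' h0'
      · rcases h1 with rfl | rfl <;> rcases h1' with rfl | rfl
        · exact .inl rfl
        · exact .inr (hpq h)
        · exact .inr (hpq h.symm)
        · exact .inl rfl
      · have := hbig l h1
        rw [h, fl l' h1' h2' h3' h4'] at this
        linarith [hδl l']
    · rw [fl l h1 h2 h3 h4] at h
      rcases hcases l' with h1' | h1' | ⟨h1', h2', h3', h4'⟩
      · exact absurd h1' h0'
      · have := hbig l' h1'
        linarith [hδl l]
      · rw [fl l' h1' h2' h3' h4'] at h
        left
        have h5 := mul_left_cancel₀ hδ0.ne' h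
        exact Fin.ext (pow_right_injective₀ (by norm_num) (by norm_num) h5)

/-- The disc type that separates `A` from its complement. -/
def DiscType.of {n k : ℕ} (A : Finset (Fin (n + 1))) (hA : A.card = k) : DiscType n k :=
  ⟨s(A, Aᶜ), A, hA, rfl⟩

theorem mem_disc_of_iff {n k : ℕ} {A : Finset (Fin (n + 1))} (hA : A.card = k) {x : Simplex n} :
    x ∈ disc (DiscType.of A hA) ↔ ∑ l ∈ A, x l = 1 / 2 := by
  rw [mem_disc_iff]
  have h : ∑ i ∈ A, x i + ∑ i ∈ Aᶜ, x i = 1 := by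
    rw [Finset.sum_add_sum_compl]; exact x.2.2
  constructor
  · exact fun h => h A (Sym2.mem_mk_left _ _)
  · intro h1 B hB
    rcases Sym2.mem_iff.1 hB with rfl | rfl
    · exact h1
    · linarith

/-- The image of `A` contains `j`, so it is not `A`, and it contains `p`, so it is not the
complement. -/
theorem DiscType.map_swap_of_ne {n k : ℕ} {A : Finset (Fin (n + 1))} (hA : A.card = k)
    {i j p : Fin (n + 1)} (hi : i ∈ A) (hj : j ∉ A) (hp : p ∈ A) (hpi : p ≠ i) :
    (DiscType.of A hA).map (Equiv.swap i j) ≠ DiscType.of A hA := by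
  intro h
  have h1 : A.map (Equiv.swap i j).toEmbedding ∈ s(A, Aᶜ) := by
    have h2 : A.map (Equiv.swap i j).toEmbedding ∈
        ((DiscType.of A hA).map (Equiv.swap i j)).1 := Sym2.mem_mk_left _ _
    rwa [h] at h2
  have hpj : p ≠ j := fun h => hj (h ▸ hp)
  rcases Sym2.mem_iff.1 h1 with h1 | h1
  · apply hj
    rw [← h1, Finset.mem_map_equiv]
    simpa using hi
  · refine Finset.mem_compl.1 (?_ : p ∈ Aᶜ) hp
    rw [← h1, Finset.mem_map_equiv, Equiv.symm_swap, Equiv.swap_apply_of_ne_of_ne hpi hpj]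
    exact hp

/-- A point of the open face opposite to `i` and `j` can be pushed into the interior of the simplex
without changing the weight of `A`. -/
theorem exists_interior_point_near {n : ℕ} {A : Finset (Fin (n + 1))} {i j p q : Fin (n + 1)}
    (hi : i ∈ A) (hj : j ∉ A) (hp : p ∈ A) (hpi : p ≠ i) (hq : q ∉ A) (hqj : q ≠ j)
    {x : Simplex n} (hz : zeros x = {i, j}) {ε : ℝ} (hε : 0 < ε) :
    ∃ y : Simplex n, zeros y = ∅ ∧ y i = y j ∧ dist y x < ε ∧ ∑ l ∈ A, y l = ∑ l ∈ A, x l := by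
  have hij : i ≠ j := fun h => hj (h ▸ hi)
  have hpj : p ≠ j := fun h => hj (h ▸ hp)
  have hqi : q ≠ i := fun h => hq (h ▸ hi)
  have hpq : p ≠ q := fun h => hq (h ▸ hp)
  have hmem : ∀ l, x l = 0 ↔ l = i ∨ l = j := fun l => by
    rw [← mem_zeros, hz]; simp
  have hxij : x i = x j := ((hmem i).2 (.inl rfl)).trans ((hmem j).2 (.inr rfl)).symm
  have hpos : ∀ l, ¬ (l = i ∨ l = j) → 0 < x l := fun l hl =>
    lt_of_le_of_ne (x.2.1 l) (fun h => hl ((hmem l).1 h.symm))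
  have hxp := hpos p (by tauto)
  have hxq := hpos q (by tauto)
  obtain ⟨t, ht0, ht⟩ := exists_between (lt_min (half_pos hε) (lt_min hxp hxq))
  simp only [lt_min_iff] at ht
  obtain ⟨htε, htp, htq⟩ := ht
  -- The weight `t` goes from `p` to `i` within `A`, then from `q` to `j` outside `A`.
  set x₁ := x.shift i p t ht0.le htp.le with hx₁
  have hx₁q : t ≤ x₁ q := by
    rw [hx₁, Simplex.shift_apply, if_neg hqi, if_neg hpq.symm]; linarith
  set y := x₁.shift j q t ht0.le hx₁q with hy
  have hyl : ∀ l, y l = x l + (if l = i then t else 0) - (if l = p then t else 0) +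
      (if l = j then t else 0) - (if l = q then t else 0) := fun l => rfl
  have hyd : dist y x < ε := by
    have h1 := Simplex.dist_shift_lt x i p ht0.le htp.le htε
    have h2 := Simplex.dist_shift_lt x₁ j q ht0.le hx₁q htε
    have h3 := dist_triangle y x₁ x
    linarith
  have hyij : y i = y j := by
    rw [hyl, hyl, hxij]
    simp [hij, hij.symm, hpi.symm, hpj.symm, hqi.symm, hqj.symm]
  have hy0 : zeros y = ∅ := by
    refine Set.eq_empty_of_forall_notMem fun l hl => ?_
    rw [mem_zeros, hyl] at hl
    by_cases h1 : l = i
    · subst h1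
      simp [hij, hpi.symm, hqi.symm, (hmem l).2 (.inl rfl)] at hl
      linarith
    by_cases h2 : l = j
    · subst h2
      simp [h1, hpj.symm, hqj.symm, (hmem l).2 (.inr rfl)] at hl
      linarith
    have := hpos l (by tauto)
    rw [if_neg h1, if_neg h2] at hl
    by_cases h3 : l = p
    · subst h3
      simp [hpq] at hl
      linarith
    by_cases h4 : l = q
    · subst h4
      simp [h3] at hl
      linarith
    simp [h3, h4] at hl
    linarith
  refine ⟨y, hy0, hyij, hyd, ?_⟩
  simp only [hyl, Finset.sum_sub_distrib, Finset.sum_add_distrib, Finset.sum_ite_eq']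
  simp [hi, hp, hj, hq]

/-! ### Branching over a face of odd degree. -/

namespace Triangulation

variable {n : ℕ} {S : Type*} {T : Triangulation n S}

/-- An edge of a tetrahedron is never glued to itself by a nontrivial symmetry. -/
theorem Chain.apply_eq_self_of_three {T : Triangulation 3 S} {σ : S} {x : Simplex 3}
    {i j : Fin 4} (hij : i ≠ j) (hz : zeros x = {i, j}) {m : ℕ} {w : Equiv.Perm (Fin 4)}
    (h : T.Chain {i, j} σ m σ w) (hw : x.permute w = x) {l : Fin 4} (hl : x l ≠ 0) : w l = l := by
  by_contra hne
  have hli : l ≠ i := by rintro rfl; exact hl (mem_zeros.1 (hz ▸ by simp))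
  have hlj : l ≠ j := by rintro rfl; exact hl (mem_zeros.1 (hz ▸ by simp))
  -- The length of the closed chain determines both the sign of `w` and its action on `i`, `j`.
  -- Flipping the other two corners as well would give the wrong sign.
  have hsgn := h.sign_loop
  have hloop := h.loop_apply hij hz hw
  clear hw hz h hl
  obtain ⟨hm, h1, h2⟩ | ⟨hm, h1, h2⟩ := hloop
  · rw [hm.neg_one_pow] at hsgn
    have : ∀ (w : Equiv.Perm (Fin 4)) (i j l : Fin 4), i ≠ j → l ≠ i → l ≠ j → w i = i → w j = j →
      w l ≠ l → Equiv.Perm.sign w ≠ 1 := by decide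
    exact this w i j l hij hli hlj h1 h2 hne hsgn
  · rw [hm.neg_one_pow] at hsgn
    have : ∀ (w : Equiv.Perm (Fin 4)) (i j l : Fin 4), i ≠ j → l ≠ i → l ≠ j → w i = j → w j = i →
      w l ≠ l → Equiv.Perm.sign w ≠ -1 := by decide
    exact this w i j l hij hli hlj h1 h2 hne hsgn

theorem isFree_of_generic {x : Simplex n} {i j : Fin (n + 1)} (hij : i ≠ j)
    (hz : zeros x = {i, j}) (hx : ∀ l l', x l ≠ 0 → x l = x l' → l = l' ∨ n = 3) (σ : S) :
    T.IsFree ⟨σ, x⟩ := by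
  refine isFree_of_loops fun m w h hw l hl => ?_
  have hwl : x l = x (w l) := by
    conv_rhs => rw [← hw]
    simp
  rcases hx l (w l) hl hwl with h1 | rfl
  · exact h1.symm
  · rw [hz] at h
    exact h.apply_eq_self_of_three hij hz hw hl

theorem exists_ball_subset_of_mem_nhds {k : ℕ} {p : S × DiscType n k} {x : Simplex n}
    (hx : x ∈ disc p.2) {U : Set (T.Hypersurface k)}
    (hU : U ∈ 𝓝 (Quot.mk (T.DiscGlue k) ⟨p, x, hx⟩ : T.Hypersurface k)) :
    ∃ ε > 0, ∀ (y : Simplex n) (hy : y ∈ disc p.2), dist y x < ε →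
      (Quot.mk (T.DiscGlue k) ⟨p, y, hy⟩ : T.Hypersurface k) ∈ U := by
  have hc : Continuous fun y : disc p.2 => (Quot.mk (T.DiscGlue k) ⟨p, y⟩ : T.Hypersurface k) :=
    (continuous_quot_mk (r := T.DiscGlue k)).comp continuous_sigmaMk
  obtain ⟨ε, hε, h⟩ := Metric.mem_nhds_iff.1 (hc.continuousAt (x := ⟨x, hx⟩) hU)
  exact ⟨ε, hε, fun y hy hd => h (show (⟨y, hy⟩ : disc p.2) ∈ Metric.ball ⟨x, hx⟩ ε from hd)⟩

theorem HypersurfaceIsImmersion.isEven (hn : 3 ≤ n) {k : ℕ} (hk : 1 < k) (hkn : 2 * k ≤ n + 1)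
    (hI : T.HypersurfaceIsImmersion k) : T.IsEven := by
  classical
  rintro ⟨σ, x₀⟩ hcard hr
  by_contra hodd
  rw [Nat.not_even_iff_odd] at hodd
  dsimp only at hcard
  have hz₀ : ∃ i j, i ≠ j ∧ zeros x₀ = {i, j} := by
    have hz : zeros x₀ = ((support x₀)ᶜ : Finset (Fin (n + 1))) := by
      ext l; simp [mem_support, mem_zeros]
    obtain ⟨i, j, hij, h⟩ := Finset.card_eq_two.1
      (show (support x₀)ᶜ.card = 2 by rw [Finset.card_compl, Fintype.card_fin]; omega)
    exact ⟨i, j, hij, by rw [hz, h]; simp⟩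
  obtain ⟨i, j, hij, hz₀⟩ := hz₀
  obtain ⟨m, hswap⟩ := exists_chain_swap_of_odd hij hz₀ (hr.2 _ rfl) hodd
  obtain ⟨A, hA, hi, hj⟩ := exists_card_eq_mem_notMem hk hkn hij
  -- On the open face opposite to `i` and `j`, each side of the partition needs a further corner to
  -- carry its weight `1 / 2`; otherwise the disc would miss that face.
  obtain ⟨p, hp, hpi⟩ := Finset.exists_mem_ne (hA ▸ hk) i
  obtain ⟨q, hq, hqj⟩ := Finset.exists_mem_ne (s := Aᶜ)
    (by rw [Finset.card_compl, Fintype.card_fin]; omega) j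
  rw [Finset.mem_compl] at hq
  obtain ⟨x, hz, hsum, hgen⟩ := exists_generic_point hi hj hp hpi hq hqj
  have hmem : ∀ l, x l = 0 ↔ l = i ∨ l = j := fun l => by
    rw [← mem_zeros, hz]; simp
  have hx := (mem_disc_of_iff hA).2 hsum
  have hpermute : ∀ y : Simplex n, y i = y j → y.permute (Equiv.swap i j) = y := fun y h =>
    Simplex.ext fun l => by
      rw [Simplex.permute_apply, Equiv.symm_swap, Equiv.swap_apply_def]
      split_ifs with h1 h2
      · rw [h1, h]
      · rw [h2, h]
      · rfl
  set ν := DiscType.of A hA with hν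
  have hmap : ∀ y : Simplex n, y i = y j → y ∈ disc ν → y ∈ disc (ν.map (Equiv.swap i j)) :=
    fun y h hy => by
      have := permute_mem_disc hy (Equiv.swap i j)
      rwa [hpermute y h] at this
  have hxij : x i = x j := ((hmem i).2 (.inl rfl)).trans ((hmem j).2 (.inr rfl)).symm
  have hfree : T.IsFree ⟨σ, x⟩ := isFree_of_generic hij hz hgen σ
  have hcx : n - 1 ≤ (support x).card := by
    have h1 : support x = support x₀ := support_eq_support_iff.2 (hz.trans hz₀.symm)
    rw [h1, hcard]
  obtain ⟨U, hU, hinj⟩ := hI (Quot.mk (T.DiscGlue k) ⟨(σ, ν), x, hx⟩)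
    (isRegular_of_isFree hn hfree hcx)
  -- The exchange chain found at `x₀` depends only on the open face, so it is also available at the
  -- generic point `x`, where it joins `ν` to its mirror image.
  have hqq : Quot.mk (T.DiscGlue k) ⟨(σ, ν), x, hx⟩ =
      Quot.mk (T.DiscGlue k) ⟨(σ, ν.map (Equiv.swap i j)), x, hmap x hxij hx⟩ := by
    rw [(hz ▸ hswap : T.Chain (zeros x) σ m σ _).discs_mk_eq hx]
    exact discs_mk_congr σ rfl (hpermute x hxij)
  obtain ⟨ε₁, hε₁, hU₁⟩ := exists_ball_subset_of_mem_nhds (p := (σ, ν)) hx hU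
  rw [hqq] at hU
  obtain ⟨ε₂, hε₂, hU₂⟩ := exists_ball_subset_of_mem_nhds 
    (p := (σ, ν.map (Equiv.swap i j))) (hmap x hxij hx) hU
  -- This point lies in both discs and in no facet, so it gives two different points of `U` with the
  -- same image.
  obtain ⟨y, hy0, hyij, hyd, hysum⟩ := exists_interior_point_near hi hj hp hpi hq hqj hz
    (lt_min hε₁ hε₂)
  have hydisc : y ∈ disc ν := (mem_disc_of_iff hA).2 (hysum.trans hsum)
  have hfin := hinj (hU₁ y hydisc (lt_min_iff.1 hyd).1)
    (hU₂ y (hmap y hyij hydisc) (lt_min_iff.1 hyd).2) rfl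
  obtain ⟨_, w, hc, h1, -⟩ := chain_of_discs_mk_eq hfin
  rw [hy0] at hc
  rw [hc.eq_of_empty, DiscType.map_one] at h1
  exact DiscType.map_swap_of_ne hA hi hj hp hpi h1

end Triangulation
end PseudoManifold

theorem mainTheorem9 (n : ℕ) (hn : 3 ≤ n) (k : ℕ) (hk : 1 < k) (hkn : 2 * k ≤ n + 1)
    {S : Type*} [Finite S] (T : PseudoManifold.Triangulation n S) :
    T.HypersurfaceIsImmersion k ↔ T.IsEven :=
  ⟨fun h => h.isEven hn hk hkn, fun h => h.hypersurfaceIsImmersion hn k⟩
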